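/- Let $\alpha\in\mathbb R$ with $\alpha/2\pi$ irrational, let $X=\mathbb R/2\pi\mathbb Z$ with normalized Lebesgue measure $\mu$ and $T(x)=x+\alpha$. Let $\lambda_1$ be the unitary $v\mapsto v\circ T$ on $L^2(X,\mu)$. Let $\mathcal C=C(X)\rtimes_r\mathbb Z$, realised as the $C^*$-algebra on $L^2(X,\mu)$ generated by $\lambda_1$ and the multiplication operators by functions in $C(X)$, and let $C^*_r(\mathbb Z)\subset\mathcal C$ be the $C^*$-subalgebra generated by $\lambda_1$. Put $S^1=\mathbb R/2\pi\mathbb Z$ and $\tau(t)=t+\alpha$ on $S^1$, and let $\phi\mapsto\hat\phi$ be the isomorphism $C(S^1)\to C^*_r(\mathbb Z)$ sending $e^{it}$ to $\lambda_1$. An intermediate algebra is a $C^*$-algebra $\mathcal A$ with $C^*_r(\mathbb Z)\subset\mathcal A\subset\mathcal C$. For an intermediate algebra $\mathcal A$ and $n\in\mathbb Z$ let $\mathfrak c(n)=\{\eta\in C^*_r(\mathbb Z): e^{inx}\eta\in\mathcal A\}$, a closed ideal of $C^*_r(\mathbb Z)$; let $\tilde{\mathfrak c}(n)=\{t\in S^1:\phi(t)=0\text{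 for all }\phi\text{ with }\hat\phi\in\mathfrak c(n)\}$ be the corresponding closed subset of $S^1$, and let $\operatorname{Supp}(\mathfrak c)=\{n\in\mathbb Z:\mathfrak c(n)\neq(0)\}$. For a closed two-sided ideal $J\lhd\mathcal A$ define $\mathfrak j(n)=\{\eta\in C^*_r(\mathbb Z): e^{inx}\eta\in J\}$, $\tilde{\mathfrak j}(n)$ and $\operatorname{Supp}(\mathfrak j)$ in the same way. An intermediate algebra $\mathcal A\neq C^*_r(\mathbb Z)$ is called residual if $\tilde{\mathfrak c}(n)$ is nowhere dense for every $n\in\operatorname{Supp}(\mathfrak c)$. A closed two-sided ideal $J\neq(0)$ in a residual algebra is called residual if $\tilde{\mathfrak j}(n)$ is nowhere dense for every $n\in\operatorname{Supp}(\mathfrak j)$. Then: 1. Every intermediate algebra containing a residual algebra is residual. 2. The intersection of two, and hence of any finite nonempty collection of, residual algebras is residual. 3. If $\mathcal A$ is residual, then $\operatorname{Supp}(\mathfrak c)$ is a subgroup of $\mathbb Z$. 4. If $\mathcal A$ is residual and $J\neq(0)$ is a closed two-sided ideal of $\mathcal A$, then $\operatorname{Supp}(\mathfrak j)=\operatorname{Supp}(\mathfrak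 c)$. 5. In the situation of 4, put $\Omega=\bigcup_{m,n\in\operatorname{Supp}(\mathfrak c)}\tau^{-m}\tilde{\mathfrak c}(n)$. Then $\tilde{\mathfrak j}(k)\subset\Omega$ for every $k\in\operatorname{Supp}(\mathfrak c)$, and $J$ is residual. 6. If $\mathcal A$ is residual, then the center of $\mathcal A$ is $\mathbb C\cdot 1$. More generally, the center of an intermediate algebra $\mathcal A$ is $\mathbb C\cdot 1$ as soon as $\tilde{\mathfrak c}(n)$ is nowhere dense for one $n\neq0$. -/

import Mathlib

open MeasureTheory AddCircle Set
open scoped Real ENNReal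

noncomputable section

namespace RotationAlgebra

instance fact_two_pi_pos : Fact (0 < 2 * π) := ⟨Real.two_pi_pos⟩

/-- The circle `ℝ / 2πℤ`. It serves both as the phase space `X` of the rotation and as the
dual circle `S¹` of `ℤ`. -/
abbrev Circ : Type := AddCircle (2 * π)

/-- The Hilbert space `L²(X, μ)`, where `μ` is normalized Lebesgue measure. -/
abbrev H : Type := Lp ℂ 2 (haarAddCircle (T := 2 * π))

/-- The bounded operators on `L²(X, μ)`. -/
abbrev B : Type := H →L[ℂ] H

theorem measurePreserving_rotation (a : Circ) :
    MeasurePreserving (fun x : Circ => x + a)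
      (haarAddCircle (T := 2 * π)) (haarAddCircle (T := 2 * π)) :=
  measurePreserving_add_right _ a

/-- The operator `v ↦ v ∘ (x ↦ x + a)` on `L²(X, μ)`. -/
def translation (a : Circ) : H →ₗᵢ[ℂ] H :=
  Lp.compMeasurePreservingₗᵢ ℂ (fun x : Circ => x + a) (measurePreserving_rotation a)

/-- The Koopman operator `λ₁ = U_T : v ↦ v ∘ T` of the rotation `T x = x + α`. -/
def koopman (α : ℝ) : B := (translation (α : Circ)).toContinuousLinearMap

/-- The multiplication operator `M_f : v ↦ f v` of `f ∈ C(X)`. -/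
def mulOp (f : C(Circ, ℂ)) : B :=
  (ContinuousLinearMap.mul ℂ ℂ).holderL (haarAddCircle (T := 2 * π)) ∞ 2 2
    (ContinuousMap.toLp ∞ (haarAddCircle (T := 2 * π)) ℂ f)

/-- The crossed product `C(X) ⋊ᵣ ℤ`, realised as the C⋆-algebra of operators on `L²(X, μ)`
generated by the Koopman operator and the multiplication operators `M_f`, `f ∈ C(X)`. -/
def crossedProduct (α : ℝ) : StarSubalgebra ℂ B :=
  (StarAlgebra.adjoin ℂ (insert (koopman α) (Set.range mulOp))).topologicalClosure

/-- `C⋆ᵣ(ℤ)`: the C⋆-subalgebra generated by the Koopman operator `λ₁`. -/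
abbrev groupAlgebra (α : ℝ) : StarSubalgebra ℂ B := StarAlgebra.elemental ℂ (koopman α)

theorem translation_translation (a b : Circ) (h : a + b = 0) (v : H) :
    translation a (translation b v) = v := by
  apply Lp.ext
  have h1 : (translation a (translation b v) : Circ → ℂ)
      =ᵐ[haarAddCircle] (translation b v : Circ → ℂ) ∘ fun x => x + a :=
    Lp.coeFn_compMeasurePreserving _ (measurePreserving_rotation a)
  have h2 : (translation b v : Circ → ℂ) =ᵐ[haarAddCircle] (v : Circ → ℂ) ∘ fun x => x + b :=
    Lp.coeFn_compMeasurePreserving _ (measurePreserving_rotation b)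
  have h3 := (measurePreserving_rotation a).quasiMeasurePreserving.ae_eq_comp h2
  filter_upwards [h1, h3] with x hx hx'
  rw [hx, hx']
  simp [add_assoc, h]

theorem koopman_mem_unitary (α : ℝ) : koopman α ∈ unitary B := by
  have h1 : star (koopman α) * koopman α = 1 := by
    rw [ContinuousLinearMap.star_eq_adjoint]
    exact (ContinuousLinearMap.norm_map_iff_adjoint_comp_self _).1
      (translation (α : Circ)).norm_map
  have h2 : koopman α * (translation (-(α : Circ))).toContinuousLinearMap = 1 :=
    ContinuousLinearMap.ext fun v => translation_translation _ _ (by simp) v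
  have h3 : star (koopman α) = (translation (-(α : Circ))).toContinuousLinearMap := by
    calc star (koopman α)
        = star (koopman α) * (koopman α * (translation (-(α : Circ))).toContinuousLinearMap) := by
          rw [h2, mul_one]
      _ = _ := by rw [← mul_assoc, h1, one_mul]
  exact Unitary.mem_iff.2 ⟨h1, by rw [h3, h2]⟩

instance koopman_isStarNormal (α : ℝ) : IsStarNormal (koopman α) :=
  ⟨by
    have h := Unitary.mem_iff.1 (koopman_mem_unitary α)
    rw [commute_iff_eq, h.1, h.2]⟩

/-- The spectrum of `λ₁` lies on the unit circle. -/
def spectrumToCircle (α : ℝ) (z : spectrum ℂ (koopman α)) : Circle :=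
  ⟨z.1, by
    simpa [Submonoid.unitSphere] using
      spectrum.subset_circle_of_unitary (koopman_mem_unitary α) z.2⟩

theorem continuous_spectrumToCircle (α : ℝ) : Continuous (spectrumToCircle α) :=
  continuous_subtype_val.subtype_mk _

/-- The spectrum of `λ₁` as a part of `S¹ = ℝ / 2πℤ`, through `t ↦ e^{it}`. -/
def spectrumToCirc (α : ℝ) : C(spectrum ℂ (koopman α), Circ) where
  toFun z := homeomorphCircle'.symm (spectrumToCircle α z)
  continuous_toFun := homeomorphCircle'.symm.continuous.comp (continuous_spectrumToCircle α)

/-- The `⋆`-homomorphism `φ ↦ φ̂` from `C(S¹)` to `C⋆ᵣ(ℤ)` that sends `e^{it}` to `λ₁`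
(for irrational `α / 2π` it is an isomorphism). -/
def hat (α : ℝ) : C(Circ, ℂ) →⋆ₐ[ℂ] groupAlgebra α :=
  ((cfcHom (koopman_isStarNormal α)).comp
    (ContinuousMap.compStarAlgHom' ℂ ℂ (spectrumToCirc α))).codRestrict (groupAlgebra α)
      (fun _ => cfcHom_mem_elemental (koopman_isStarNormal α) _)

/-- For a set `S` of operators (an intermediate algebra, or an ideal in one), the ideal function
`n ↦ {η ∈ C⋆ᵣ(ℤ) | e^{inx} η ∈ S}`. -/
def idealFunction (α : ℝ) (S : Set B) (n : ℤ) : Set (groupAlgebra α) :=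
  {η | mulOp (fourier n) * (η : B) ∈ S}

/-- The support `{n | 𝔠(n) ≠ (0)}` of the ideal function of `S`. -/
def supp (α : ℝ) (S : Set B) : Set ℤ := {n | idealFunction α S n ≠ {0}}

/-- The set function of `S`: the closed subset of `S¹` corresponding to the ideal `𝔠(n)` under
`C⋆ᵣ(ℤ) ≅ C(S¹)`, that is, the common zeros of the functions `φ` with `φ̂ ∈ 𝔠(n)`. -/
def setFunction (α : ℝ) (S : Set B) (n : ℤ) : Set Circ :=
  {t | ∀ φ : C(Circ, ℂ), hat α φ ∈ idealFunction α S n → φ t = 0}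

/-- `A` is an intermediate C⋆-algebra `C⋆ᵣ(ℤ) ⊆ A ⊆ C(X) ⋊ᵣ ℤ`. -/
structure IsIntermediate (α : ℝ) (A : StarSubalgebra ℂ B) : Prop where
  isClosed : IsClosed (A : Set B)
  groupAlgebra_le : groupAlgebra α ≤ A
  le_crossedProduct : A ≤ crossedProduct α

/-- `A` is a residual intermediate algebra; the trivial algebra `C⋆ᵣ(ℤ)` is excluded. -/
structure IsResidual (α : ℝ) (A : StarSubalgebra ℂ B) : Prop where
  isIntermediate : IsIntermediate α A
  ne_groupAlgebra : A ≠ groupAlgebra α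
  isNowhereDense : ∀ n ∈ supp α (A : Set B), IsNowhereDense (setFunction α (A : Set B) n)

/-- A two-sided ideal of `A`, as a set of operators. -/
def idealCarrier {A : StarSubalgebra ℂ B} (J : TwoSidedIdeal A) : Set B :=
  (fun a : A => (a : B)) '' (J : Set A)

/-- `J` is a residual ideal of `A`: a closed two-sided ideal, not `(0)`, whose set function is
nowhere dense at every point of its support. -/
structure IsResidualIdeal (α : ℝ) {A : StarSubalgebra ℂ B} (J : TwoSidedIdeal A) : Prop where
  isClosed : IsClosed (J : Set A)
  ne_bot : J ≠ ⊥
  isNowhereDense : ∀ n ∈ supp α (idealCarrier J),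
    IsNowhereDense (setFunction α (idealCarrier J) n)

/-- `Ω = ⋃_{m, n ∈ Supp 𝔠} τ^{-m} 𝔠(n)`, where `τ t = t + α` on `S¹` and `𝔠(n)` denotes the closed
subset of `S¹`. -/
def omegaSet (α : ℝ) (A : StarSubalgebra ℂ B) : Set Circ :=
  ⋃ m ∈ supp α (A : Set B), ⋃ n ∈ supp α (A : Set B),
    (fun t : Circ => t - m • (α : Circ)) '' setFunction α (A : Set B) n

end RotationAlgebra

end

open MeasureTheory AddCircle Set
open scoped Real ENNReal

noncomputable section

namespace RotationAlgebra

open Filter Topology ComplexConjugate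

/-! In the Fourier basis `e k` of L², the operator φ̂ is diagonal with entries φ(kα), and
multiplication by e^{inx} shifts the index by n. So `W α n φ` = e^{inx} φ̂ is a weighted shift, its
weight φ is recovered by density of the orbit kα, and degrees add under products: `W_mul_W`.

Every operator a in the crossed product has a continuous weight φ in each degree n. Conjugation by
λ₁ multiplies degree m by e^{imα}, and these scalars are distinct, so averaging the suitably
normalized conjugates of a tends to e^{inx} φ̂. Hence a closed subspace invariant under this
conjugation contains the Fourier components of its elements in the crossed product
(`W_mem_of_isCoeff`), and questions about algebras and ideals become questions about where weights
can be nonzero.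

Larger algebras and ideals are treated together as closed bimodules S over A. If A has a weight of
degree n nonzero at t + mα and S has one of degree m nonzero at t, then S has one of degree n + m
nonzero at t; likewise with the factors exchanged. Multiplying on the left by degree -p and on the
right by degree p carries nonvanishing of S in degree n from t + pα to t. For residual A the support
contains some mℤ with m ≠ 0, whose orbits are dense, while the zero sets to be avoided are closed
and nowhere dense, so finitely many of them obstruct no open set. This gives
`IsResidual.isNowhereDense_of_bimodule`, and the same moves give the statements on supports and Ω.

A central element commutes with λ₁, so it has only degree 0 and equals some φ̂; commuting with a
densely nonvanishing degree n ≠ 0 forces φ ∘ τⁿ = φ, so φ is constant. -/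

/-! ### Operators in the Fourier basis -/

/-- The Fourier basis of `L²(X, μ)`. -/
def e (k : ℤ) : H := fourierLp 2 k

theorem e_eq_basis (k : ℤ) : e k = fourierBasis (T := 2 * π) k := by
  rw [coe_fourierBasis]; rfl

theorem orthonormal_e : Orthonormal ℂ e := orthonormal_fourier

theorem ext_e {a b : B} (h : ∀ k, a (e k) = b (e k)) : a = b := by
  refine ContinuousLinearMap.ext_on (s := range e) ?_ ?_
  · have := (fourierBasis (T := 2 * π)).dense_span
    rw [coe_fourierBasis] at this
    exact Submodule.dense_iff_topologicalClosure_eq_top.2 this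
  · rintro _ ⟨k, rfl⟩
    exact h k

theorem eq_of_inner_e {x y : H} (h : ∀ j, inner ℂ (e j) x = inner ℂ (e j) y) : x = y := by
  refine (fourierBasis (T := 2 * π)).repr.injective ?_
  ext j
  rw [HilbertBasis.repr_apply_apply, HilbertBasis.repr_apply_apply, ← e_eq_basis, h j]

/-- `f ↦ M_f` as a continuous linear map. -/
def mulOpL : C(Circ, ℂ) →L[ℂ] B :=
  ((ContinuousLinearMap.mul ℂ ℂ).holderL (haarAddCircle (T := 2 * π)) ∞ 2 2).comp
    (ContinuousMap.toLp ∞ (haarAddCircle (T := 2 * π)) ℂ)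

theorem mulOp_toLp (f g : C(Circ, ℂ)) :
    mulOp f (ContinuousMap.toLp 2 (haarAddCircle (T := 2 * π)) ℂ g)
      = ContinuousMap.toLp 2 (haarAddCircle (T := 2 * π)) ℂ (f * g) := by
  apply Lp.ext
  have h := ContinuousLinearMap.coeFn_holder (r := 2) (ContinuousLinearMap.mul ℂ ℂ)
    (ContinuousMap.toLp ∞ (haarAddCircle (T := 2 * π)) ℂ f)
    (ContinuousMap.toLp 2 (haarAddCircle (T := 2 * π)) ℂ g)
  refine h.trans ?_
  filter_upwards [ContinuousMap.coeFn_toLp (p := ∞) (𝕜 := ℂ) (haarAddCircle (T := 2 * π)) f,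
    ContinuousMap.coeFn_toLp (p := 2) (𝕜 := ℂ) (haarAddCircle (T := 2 * π)) g,
    ContinuousMap.coeFn_toLp (p := 2) (𝕜 := ℂ) (haarAddCircle (T := 2 * π)) (f * g)]
    with x h1 h2 h3
  rw [h1, h2, h3]
  simp

theorem fourier_mul_fourier (m n : ℤ) :
    (fourier m * fourier n : C(Circ, ℂ)) = fourier (m + n) := by
  ext x
  simp

theorem mulOp_fourier_e (n k : ℤ) : mulOp (fourier n) (e k) = e (k + n) := by
  rw [e, fourierLp, mulOp_toLp, fourier_mul_fourier, add_comm n k]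
  rfl

theorem koopman_e (α : ℝ) (k : ℤ) :
    koopman α (e k) = fourier 1 (k • (α : Circ)) • e k := by
  apply Lp.ext
  have h1 : (koopman α (e k) : Circ → ℂ) =ᵐ[haarAddCircle] (e k : Circ → ℂ) ∘ fun x => x + α :=
    Lp.coeFn_compMeasurePreserving _ (measurePreserving_rotation (α : Circ))
  have h2 : (e k : Circ → ℂ) =ᵐ[haarAddCircle] fourier k := coeFn_fourierLp 2 k
  have h3 := (measurePreserving_rotation (α : Circ)).quasiMeasurePreserving.ae_eq_comp h2
  filter_upwards [h1, h2, h3, Lp.coeFn_smul (fourier 1 (k • (α : Circ))) (e k)] with x g1 g2 g3 g4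
  rw [g1, g3, g4, Pi.smul_apply, g2]
  simp only [Function.comp_apply, fourier_apply, one_smul, smul_add, toCircle_add, smul_eq_mul,
    Circle.coe_mul]
  ring

/-- `φ ↦ φ̂` as a homomorphism into the bounded operators. -/
def hatOp (α : ℝ) : C(Circ, ℂ) →⋆ₐ[ℂ] B :=
  (cfcHom (koopman_isStarNormal α)).comp
    (ContinuousMap.compStarAlgHom' ℂ ℂ (spectrumToCirc α))

theorem continuous_hatOp (α : ℝ) : Continuous (hatOp α) :=
  (cfcHom_continuous _).comp (spectrumToCirc α).continuous_precomp

theorem toCircle_homeomorphCircle'_symm (z : Circle) :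
    toCircle (homeomorphCircle'.symm z : Circ) = z := by
  obtain ⟨x, rfl⟩ := homeomorphCircle'.surjective z
  rw [Homeomorph.symm_apply_apply]
  induction x using QuotientAddGroup.induction_on with
  | H x =>
    rw [homeomorphCircle'_apply_mk]
    exact (toCircle_apply_mk x).trans (by rw [div_self Real.two_pi_pos.ne', one_mul])

theorem hatOp_fourier_one (α : ℝ) : hatOp α (fourier 1) = koopman α := by
  have : (ContinuousMap.compStarAlgHom' ℂ ℂ (spectrumToCirc α)) (fourier 1)
      = (ContinuousMap.id ℂ).restrict (spectrum ℂ (koopman α)) := by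
    ext z
    exact fourier_one.trans
      (congrArg Subtype.val (toCircle_homeomorphCircle'_symm (spectrumToCircle α z)))
  exact (congrArg (cfcHom (koopman_isStarNormal α)) this).trans (cfcHom_id _)

/-- Trigonometric polynomials are dense and e^{it} generates them as a ⋆-algebra, so a property of
φ̂ that cuts out a closed ⋆-subalgebra need only be checked at φ = e^{it}. -/
theorem mem_of_fourier_one {S : StarSubalgebra ℂ C(Circ, ℂ)} (hS : IsClosed (S : Set C(Circ, ℂ)))
    (h : fourier 1 ∈ S) (f : C(Circ, ℂ)) : f ∈ S := by
  have hle : (fourierSubalgebra (T := 2 * π)) ≤ S := by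
    intro g hg
    have hg' : g ∈ Submodule.span ℂ (range (fourier (T := 2 * π))) := by
      rw [← fourierSubalgebra_coe]; exact hg
    refine (Submodule.span_le (p := Subalgebra.toSubmodule S.toSubalgebra)).2 ?_ hg'
    have hn : ∀ n : ℕ, fourier (n : ℤ) ∈ S := by
      intro n
      induction n with
      | zero =>
        have : (fourier ((0 : ℕ) : ℤ) : C(Circ, ℂ)) = 1 := by
          ext x
          simp
        rw [this]
        exact S.one_mem
      | succ n ih =>
        rw [Nat.cast_succ, ← fourier_mul_fourier]
        exact S.mul_mem ih h
    rintro _ ⟨n, rfl⟩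
    obtain ⟨m, rfl | rfl⟩ := n.eq_nat_or_neg
    · exact hn m
    · have : (fourier (-(m : ℤ)) : C(Circ, ℂ)) = star (fourier (m : ℤ)) := by
        ext x
        exact fourier_neg
      rw [this]
      exact S.star_mem' (hn m)
  have := StarSubalgebra.topologicalClosure_minimal hle hS
  rw [fourierSubalgebra_closure_eq_top] at this
  exact this trivial

theorem star_koopman_e (α : ℝ) (k : ℤ) :
    star (koopman α) (e k) = conj ((fourier 1 : C(Circ, ℂ)) (k • (α : Circ))) • e k := by
  have h := (Unitary.mem_iff.1 (koopman_mem_unitary α)).1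
  have h1 : (star (koopman α)) (koopman α (e k)) = e k := by
    rw [← mul_apply_eq_comp, h]; rfl
  have h2 : conj ((fourier 1 : C(Circ, ℂ)) (k • (α : Circ))) * fourier 1 (k • (α : Circ)) = 1 := by
    rw [← Complex.normSq_eq_conj_mul_self, fourier_apply, Circle.normSq_coe, Complex.ofReal_one]
  rw [koopman_e, map_smul] at h1
  conv_rhs => rw [← h1]
  rw [smul_smul, h2, one_smul]

/-- `φ̂` is diagonal in the Fourier basis. -/
theorem hatOp_e (α : ℝ) (φ : C(Circ, ℂ)) (k : ℤ) :
    hatOp α φ (e k) = φ (k • (α : Circ)) • e k := by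
  -- The adjoint condition is carried along because an eigenvector of an operator need not be one of
  -- its adjoint; without it, closure under ⋆ would not be visible.
  let S : StarSubalgebra ℂ C(Circ, ℂ) :=
    { carrier := {φ | hatOp α φ (e k) = φ (k • (α : Circ)) • e k ∧
        (star (hatOp α φ)) (e k) = conj (φ (k • (α : Circ))) • e k}
      mul_mem' := by
        rintro a b ⟨ha, ha'⟩ ⟨hb, hb'⟩
        constructor
        · simp [ha, hb, smul_smul, mul_comm]
        · simp [ha', hb', smul_smul]
      add_mem' := by
        rintro a b ⟨ha, ha'⟩ ⟨hb, hb'⟩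
        constructor
        · simp [ha, hb, add_smul]
        · simp [ha', hb', add_smul]
      algebraMap_mem' := by
        intro r
        simp only [mem_ofPred_eq, AlgHomClass.commutes]
        rw [← algebraMap_star_comm]
        simp [Algebra.algebraMap_eq_smul_one]
      star_mem' := by
        rintro a ⟨ha, ha'⟩
        refine ⟨?_, ?_⟩
        · rw [map_star, ha']; rfl
        · rw [map_star, star_star, ha]; simp }
  have hcl : IsClosed (S : Set C(Circ, ℂ)) := by
    have hc := continuous_hatOp α
    have hev : Continuous fun φ : C(Circ, ℂ) => φ (k • (α : Circ)) :=
      ContinuousEvalConst.continuous_eval_const _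
    refine IsClosed.inter (isClosed_eq (by fun_prop) (by fun_prop))
      (isClosed_eq ?_ ?_)
    · exact (ContinuousLinearMap.apply ℂ H (e k)).continuous.comp (continuous_star.comp hc)
    · exact (Complex.continuous_conj.comp hev).smul continuous_const
  refine (mem_of_fourier_one hcl (f := φ) ⟨?_, ?_⟩).1
  · rw [hatOp_fourier_one, koopman_e]
  · rw [hatOp_fourier_one, star_koopman_e]

/-! ### The operators `e^{inx} φ̂` -/

/-- The operator `e^{inx} φ̂`. -/
def W (α : ℝ) (n : ℤ) : C(Circ, ℂ) →ₗ[ℂ] B :=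
  (LinearMap.mulLeft ℂ (mulOp (fourier n))).comp (hatOp α).toLinearMap

theorem W_apply (α : ℝ) (n : ℤ) (φ : C(Circ, ℂ)) :
    W α n φ = mulOp (fourier n) * hatOp α φ := rfl

theorem W_e (α : ℝ) (n k : ℤ) (φ : C(Circ, ℂ)) :
    W α n φ (e k) = φ (k • (α : Circ)) • e (k + n) := by
  rw [W_apply, mul_apply_eq_comp, hatOp_e, map_smul, mulOp_fourier_e]

/-- `φ ∘ τᵐ`. -/
def shift (α : ℝ) (m : ℤ) (φ : C(Circ, ℂ)) : C(Circ, ℂ) :=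
  φ.comp ⟨fun t => t + m • (α : Circ), by fun_prop⟩

theorem shift_apply (α : ℝ) (m : ℤ) (φ : C(Circ, ℂ)) (t : Circ) :
    shift α m φ t = φ (t + m • (α : Circ)) := rfl

/-- The right factor moves index k to k + m before φ is read off, so φ is evaluated at kα + mα. -/
theorem W_mul_W (α : ℝ) (n m : ℤ) (φ ψ : C(Circ, ℂ)) :
    W α n φ * W α m ψ = W α (n + m) (shift α m φ * ψ) := by
  refine ext_e fun k => ?_
  rw [mul_apply_eq_comp, W_e, map_smul, W_e, W_e, smul_smul, ContinuousMap.mul_apply, shift_apply,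
    add_smul, add_assoc, add_comm m n]
  congr 1
  exact mul_comm _ _

theorem mulOp_fourier_zero : mulOp (fourier 0) = 1 :=
  ext_e fun k => by rw [mulOp_fourier_e, add_zero]; rfl

theorem W_zero (α : ℝ) (φ : C(Circ, ℂ)) : W α 0 φ = hatOp α φ := by
  rw [W_apply, mulOp_fourier_zero, one_mul]

theorem W_one (α : ℝ) (n : ℤ) : W α n 1 = mulOp (fourier n) := by
  rw [W_apply, map_one, mul_one]

theorem star_mulOp_fourier (n : ℤ) : star (mulOp (fourier n)) = mulOp (fourier (-n)) := by
  refine ext_e fun k => ?_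
  refine eq_of_inner_e fun j => ?_
  rw [ContinuousLinearMap.star_eq_adjoint, ContinuousLinearMap.adjoint_inner_right,
    mulOp_fourier_e, mulOp_fourier_e]
  simp only [orthonormal_iff_ite.1 orthonormal_e]
  congr 1
  simp only [eq_iff_iff]
  omega

theorem star_W (α : ℝ) (n : ℤ) (φ : C(Circ, ℂ)) :
    star (W α n φ) = W α (-n) (shift α (-n) (star φ)) := by
  rw [W_apply, star_mul, star_mulOp_fourier, ← map_star, ← W_zero, ← W_one α, W_mul_W, zero_add,
    mul_one]

theorem continuous_W (α : ℝ) (n : ℤ) : Continuous (W α n) :=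
  continuous_const.mul (continuous_hatOp α)

/-! ### Minimality of the rotation -/

theorem irrational_mul {α : ℝ} (hα : Irrational (α / (2 * π))) {n : ℤ} (hn : n ≠ 0) :
    Irrational (n * α / (2 * π)) := by
  rw [mul_div_assoc]
  exact hα.intCast_mul hn

theorem denseRange_zsmul {α : ℝ} (hα : Irrational (α / (2 * π))) {n : ℤ} (hn : n ≠ 0) :
    DenseRange fun j : ℤ => j • n • (α : Circ) := by
  have h := AddCircle.denseRange_zsmul_coe_iff.2 (irrational_mul hα hn)
  have h2 : (((n * α : ℝ)) : Circ) = n • (α : Circ) := by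
    rw [← zsmul_eq_mul]; rfl
  rwa [h2] at h

theorem denseRange_orbit {α : ℝ} (hα : Irrational (α / (2 * π))) :
    DenseRange fun j : ℤ => j • (α : Circ) := by
  simpa using denseRange_zsmul hα one_ne_zero

/-- Minimality of τⁿ for n ≠ 0, with displacements kept in nℤ so that they stay in the support of a
residual algebra. -/
theorem exists_zsmul_mem {α : ℝ} (hα : Irrational (α / (2 * π))) {n : ℤ} (hn : n ≠ 0)
    {V : Set Circ} (hV : IsOpen V) (hne : V.Nonempty) (t : Circ) :
    ∃ j : ℤ, t + (j * n) • (α : Circ) ∈ V := by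
  obtain ⟨v, hv⟩ := hne
  obtain ⟨j, hj⟩ := (denseRange_zsmul hα hn).exists_mem_open
    (hV.preimage (continuous_const_add t)) ⟨v - t, by simpa using hv⟩
  exact ⟨j, by rwa [mul_zsmul]⟩

/-- Otherwise nα = 0 in the circle and its multiples could not be dense. This is what separates the
degrees under conjugation by λ₁. -/
theorem fourier_alpha_ne_one {α : ℝ} (hα : Irrational (α / (2 * π))) {n : ℤ} (hn : n ≠ 0) :
    (fourier n : C(Circ, ℂ)) (α : Circ) ≠ 1 := by
  intro h
  rw [fourier_apply] at h
  have h1 : toCircle (n • (α : Circ)) = toCircle (0 : Circ) := by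
    rw [toCircle_zero]
    exact Circle.ext h
  have h2 := injective_toCircle Real.two_pi_pos.ne' h1
  have h3 := (denseRange_zsmul hα hn).exists_mem_open (isOpen_compl_singleton (x := 0))
    ⟨((π : ℝ) : Circ), fun h => ?_⟩
  · simp [h2] at h3
  · obtain ⟨m, hm⟩ := (AddCircle.coe_eq_zero_iff _).1 h
    rw [zsmul_eq_mul] at hm
    have h4 : (m : ℝ) * 2 = 1 :=
      mul_right_cancel₀ Real.pi_ne_zero (by linarith)
    have h5 : m * 2 = 1 := by exact_mod_cast h4
    omega

theorem norm_le_of_orbit {α : ℝ} (hα : Irrational (α / (2 * π))) {φ : C(Circ, ℂ)} {C : ℝ}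
    (h : ∀ k : ℤ, ‖φ (k • (α : Circ))‖ ≤ C) : ‖φ‖ ≤ C := by
  refine (ContinuousMap.norm_le _ ((norm_nonneg _).trans (h 0))).2 fun t => ?_
  exact (denseRange_orbit hα).induction_on t
    (isClosed_le (by fun_prop) continuous_const) h

theorem eq_of_orbit {α : ℝ} (hα : Irrational (α / (2 * π))) {φ ψ : C(Circ, ℂ)}
    (h : ∀ k : ℤ, φ (k • (α : Circ)) = ψ (k • (α : Circ))) : φ = ψ :=
  ContinuousMap.coe_injective <|
    (denseRange_orbit hα).equalizer φ.continuous ψ.continuous (funext h)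

/-! ### Fourier coefficients -/

theorem norm_e (k : ℤ) : ‖e k‖ = 1 := orthonormal_e.1 k

theorem inner_W (α : ℝ) (m n k : ℤ) (φ : C(Circ, ℂ)) :
    inner ℂ (e (k + n)) (W α m φ (e k)) = if n = m then φ (k • (α : Circ)) else 0 := by
  rw [W_e, inner_smul_right, orthonormal_iff_ite.1 orthonormal_e]
  simp

theorem W_injective {α : ℝ} (hα : Irrational (α / (2 * π))) (n : ℤ) :
    Function.Injective (W α n) := by
  intro φ ψ h
  refine eq_of_orbit hα fun k => ?_
  have h1 := inner_W α n n k φ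
  rwa [h, inner_W, if_pos rfl, if_pos rfl, eq_comm] at h1

theorem norm_inner_e_le (a : B) (j k : ℤ) : ‖inner ℂ (e j) (a (e k))‖ ≤ ‖a‖ := by
  refine (norm_inner_le_norm _ _).trans ?_
  rw [norm_e, one_mul]
  simpa [norm_e] using a.le_opNorm (e k)

/-- Conjugation by `λ₁`, normalized to fix `e^{inx} φ̂`. -/
def twist (α : ℝ) (n : ℤ) : B →ₗ[ℂ] B :=
  (fourier (-n) : C(Circ, ℂ)) (α : Circ) •
    (LinearMap.mulLeft ℂ (koopman α)).comp (LinearMap.mulRight ℂ (star (koopman α)))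

theorem twist_apply (α : ℝ) (n : ℤ) (a : B) :
    twist α n a =
      (fourier (-n) : C(Circ, ℂ)) (α : Circ) • (koopman α * (a * star (koopman α))) := rfl

theorem norm_fourier_apply (n : ℤ) (t : Circ) : ‖(fourier n : C(Circ, ℂ)) t‖ = 1 := by
  rw [fourier_apply, Circle.norm_coe]

theorem norm_twist_le (α : ℝ) (n : ℤ) (a : B) : ‖twist α n a‖ ≤ ‖a‖ := by
  have hu := koopman_mem_unitary α
  rw [twist_apply, norm_smul, norm_fourier_apply, one_mul, CStarRing.norm_mem_unitary_mul _ hu,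
    CStarRing.norm_mul_mem_unitary _ (Unitary.star_mem hu)]

theorem lipschitzWith_twist (α : ℝ) (n : ℤ) : LipschitzWith 1 (twist α n) :=
  LipschitzWith.of_dist_le_mul fun a b => by
    rw [dist_eq_norm, dist_eq_norm, ← map_sub, NNReal.coe_one, one_mul]
    exact norm_twist_le α n _

theorem twist_W (α : ℝ) (n m : ℤ) (φ : C(Circ, ℂ)) :
    twist α n (W α m φ) = (fourier (m - n) : C(Circ, ℂ)) (α : Circ) • W α m φ := by
  refine ext_e fun k => ?_
  have h1 : (fourier 1 : C(Circ, ℂ)) ((k + m) • (α : Circ))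
      = fourier 1 (k • (α : Circ)) * fourier m (α : Circ) := by
    simp [fourier_apply, add_smul, toCircle_add]
  have h2 : conj ((fourier 1 : C(Circ, ℂ)) (k • (α : Circ))) * fourier 1 (k • (α : Circ)) = 1 := by
    rw [← Complex.normSq_eq_conj_mul_self, fourier_apply, Circle.normSq_coe, Complex.ofReal_one]
  have h3 : (fourier (m - n) : C(Circ, ℂ)) (α : Circ)
      = fourier m (α : Circ) * fourier (-n) (α : Circ) := by
    rw [sub_eq_add_neg, fourier_add]
  rw [twist_apply]
  simp only [smul_apply, mul_apply_eq_comp, star_koopman_e, map_smul, W_e,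
    koopman_e, smul_smul, h1, h3]
  congr 1
  linear_combination (fourier (-n) (α : Circ) * φ (k • (α : Circ)) * fourier m (α : Circ)) * h2

theorem birkhoffAverage_twist_add (α : ℝ) (n : ℤ) (N : ℕ) (a b : B) :
    birkhoffAverage ℂ (twist α n) id N (a + b)
      = birkhoffAverage ℂ (twist α n) id N a + birkhoffAverage ℂ (twist α n) id N b := by
  simp [birkhoffAverage, birkhoffSum, iterate_map_add, Finset.sum_add_distrib, smul_add]

theorem birkhoffAverage_twist_smul (α : ℝ) (n : ℤ) (N : ℕ) (c : ℂ) (a : B) :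
    birkhoffAverage ℂ (twist α n) id N (c • a) = c • birkhoffAverage ℂ (twist α n) id N a := by
  have (j : ℕ) : (twist α n)^[j] (c • a) = c • (twist α n)^[j] a := by
    rw [← Module.End.coe_pow, map_smul]
  simp [birkhoffAverage, birkhoffSum, this, Finset.smul_sum, smul_comm c]

/-- `φ` is the `n`-th Fourier coefficient of `a`. -/
structure IsCoeff (α : ℝ) (n : ℤ) (a : B) (φ : C(Circ, ℂ)) : Prop where
  inner_eq : ∀ k, inner ℂ (e (k + n)) (a (e k)) = φ (k • (α : Circ))
  tendsto : Tendsto (birkhoffAverage ℂ (twist α n) id · (a - W α n φ)) atTop (𝓝 0)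

theorem IsCoeff.add {α : ℝ} {n : ℤ} {a b : B} {φ ψ : C(Circ, ℂ)} (ha : IsCoeff α n a φ)
    (hb : IsCoeff α n b ψ) : IsCoeff α n (a + b) (φ + ψ) := by
  refine ⟨fun k => ?_, ?_⟩
  · rw [add_apply, inner_add_right, ha.inner_eq, hb.inner_eq]; rfl
  · have := ha.tendsto.add hb.tendsto
    simpa only [← birkhoffAverage_twist_add, add_zero, map_add, sub_add_sub_comm] using this

theorem IsCoeff.smul {α : ℝ} {n : ℤ} {a : B} {φ : C(Circ, ℂ)} (c : ℂ) (ha : IsCoeff α n a φ) :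
    IsCoeff α n (c • a) (c • φ) := by
  refine ⟨fun k => ?_, ?_⟩
  · rw [smul_apply, inner_smul_right, ha.inner_eq]; rfl
  · have := ha.tendsto.const_smul c
    simpa only [← birkhoffAverage_twist_smul, smul_zero, map_smul, smul_sub] using this

theorem isCoeff_zero (α : ℝ) (n : ℤ) : IsCoeff α n 0 0 := by
  refine ⟨fun k => by simp, ?_⟩
  have (N : ℕ) : birkhoffAverage ℂ (twist α n) id N 0 = 0 := by
    simpa using birkhoffAverage_twist_smul α n N 0 0
  simp [this]

theorem isCoeff_W_self (α : ℝ) (n : ℤ) (φ : C(Circ, ℂ)) : IsCoeff α n (W α n φ) φ := by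
  refine ⟨fun k => by rw [inner_W, if_pos rfl], ?_⟩
  simpa using (isCoeff_zero α n).tendsto

theorem isCoeff_W_of_ne {α : ℝ} (hα : Irrational (α / (2 * π))) {n m : ℤ} (h : m ≠ n)
    (φ : C(Circ, ℂ)) : IsCoeff α n (W α m φ) 0 := by
  refine ⟨fun k => by rw [inner_W, if_neg h.symm]; rfl, ?_⟩
  set c : ℂ := (fourier (m - n) : C(Circ, ℂ)) (α : Circ) with hc
  have hc1 : c - 1 ≠ 0 := sub_ne_zero.2 (fourier_alpha_ne_one hα (sub_ne_zero.2 h))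
  set x := W α m φ
  have hx : twist α n x = c • x := twist_W α n m φ
  have hiter (j : ℕ) : (twist α n)^[j] x = c ^ j • x := by
    induction j with
    | zero => simp
    | succ j ih => rw [Function.iterate_succ_apply', ih, map_smul, hx, smul_smul, pow_succ]
  have hb : Bornology.IsBounded (range fun j => id ((twist α n)^[j] x)) := by
    refine isBounded_iff_forall_norm_le.2 ⟨‖x‖, ?_⟩
    rintro _ ⟨j, rfl⟩
    simp only [id, hiter, norm_smul, norm_pow, hc, norm_fourier_apply, one_pow, one_mul, le_refl]
  -- The averages of `twist α n x` and of x differ by o(1) on a bounded orbit; since `twist α n x` =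
  -- c x, the difference is (c - 1) times the average of x, and c ≠ 1.
  have h1 := (tendsto_birkhoffAverage_apply_sub_birkhoffAverage ℂ hb).const_smul (c - 1)⁻¹
  have h2 (N : ℕ) : birkhoffAverage ℂ (twist α n) id N (x - W α n 0)
      = (c - 1)⁻¹ • (birkhoffAverage ℂ (twist α n) id N (twist α n x)
        - birkhoffAverage ℂ (twist α n) id N x) := by
    rw [hx, birkhoffAverage_twist_smul, map_zero, sub_zero]
    nth_rewrite 3 [← one_smul ℂ (birkhoffAverage ℂ (twist α n) id N x)]
    rw [← sub_smul, smul_smul, inv_mul_cancel₀ hc1, one_smul]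
  simp only [h2]
  simpa using h1

/-- The operators that have an `n`-th Fourier coefficient. -/
def coeffDomain (α : ℝ) (n : ℤ) : Submodule ℂ B where
  carrier := {a | ∃ φ, IsCoeff α n a φ}
  add_mem' := fun ⟨φ, hφ⟩ ⟨ψ, hψ⟩ => ⟨φ + ψ, hφ.add hψ⟩
  zero_mem' := ⟨0, isCoeff_zero α n⟩
  smul_mem' := fun c _ ⟨φ, hφ⟩ => ⟨c • φ, hφ.smul c⟩

/-- Values of the coefficient on the dense orbit are matrix entries, so passing to the coefficient
does not increase norms and coefficients of a convergent sequence converge. The averages are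
uniformly Lipschitz, so their convergence survives the limit. -/
theorem isClosed_coeffDomain {α : ℝ} (hα : Irrational (α / (2 * π))) (n : ℤ) :
    IsClosed (coeffDomain α n : Set B) := by
  refine IsSeqClosed.isClosed fun a x ha hx => ?_
  choose φ hφ using ha
  have hle (i j : ℕ) : dist (φ i) (φ j) ≤ dist (a i) (a j) := by
    rw [dist_eq_norm, dist_eq_norm]
    refine norm_le_of_orbit hα fun k => ?_
    have := norm_inner_e_le (a i - a j) (k + n) k
    rwa [sub_apply, inner_sub_right, (hφ i).inner_eq, (hφ j).inner_eq] at this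
  have hcau : CauchySeq φ := by
    rw [Metric.cauchySeq_iff]
    intro ε hε
    obtain ⟨N, hN⟩ := Metric.cauchySeq_iff.1 hx.cauchySeq ε hε
    exact ⟨N, fun i hi j hj => (hle i j).trans_lt (hN i hi j hj)⟩
  obtain ⟨ψ, hψ⟩ := cauchySeq_tendsto_of_complete hcau
  refine ⟨ψ, fun k => ?_, ?_⟩
  · have h1 : Tendsto (fun i => inner ℂ (e (k + n)) (a i (e k))) atTop
        (𝓝 (inner ℂ (e (k + n)) (x (e k)))) :=
      tendsto_const_nhds.inner
        (((ContinuousLinearMap.apply ℂ H (e k)).continuous.tendsto x).comp hx)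
    have h2 : Tendsto (fun i => φ i (k • (α : Circ))) atTop (𝓝 (ψ (k • (α : Circ)))) :=
      ((ContinuousEvalConst.continuous_eval_const (F := C(Circ, ℂ))
        (k • (α : Circ))).tendsto ψ).comp hψ
    simp only [(hφ _).inner_eq] at h1
    exact tendsto_nhds_unique h1 h2
  · have hcl := isClosed_setOfPred_tendsto_birkhoffAverage ℂ (lipschitzWith_twist α n)
      uniformContinuous_id (l := fun _ => (0 : B)) continuous_const
    exact hcl.mem_of_tendsto (hx.sub (((continuous_W α n).tendsto ψ).comp hψ))
      (Eventually.of_forall fun i => (hφ i).tendsto)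

/-! ### The crossed product -/

/-- The `⋆`-algebra of finite sums of operators `e^{inx} φ̂`. -/
def polyAlgebra (α : ℝ) : StarSubalgebra ℂ B where
  carrier := Submodule.span ℂ (range fun p : ℤ × C(Circ, ℂ) => W α p.1 p.2)
  add_mem' := fun ha hb => add_mem ha hb
  mul_mem' := by
    intro a b ha hb
    have h := Submodule.mul_mem_mul ha hb
    rw [Submodule.span_mul_span] at h
    refine Submodule.span_mono ?_ h
    rintro _ ⟨_, ⟨p, rfl⟩, _, ⟨q, rfl⟩, rfl⟩
    exact ⟨(_, _), (W_mul_W α p.1 q.1 p.2 q.2).symm⟩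
  algebraMap_mem' := by
    intro r
    refine Submodule.subset_span ⟨(0, algebraMap ℂ _ r), ?_⟩
    simp only [W_zero, AlgHomClass.commutes]
  star_mem' := by
    intro a ha
    refine Submodule.span_induction ?_ ?_ ?_ ?_ ha
    · rintro _ ⟨p, rfl⟩
      exact Submodule.subset_span ⟨(_, _), (star_W α p.1 p.2).symm⟩
    · rw [star_zero]; exact zero_mem _
    · intro x y _ _ hx hy
      rw [star_add]; exact add_mem hx hy
    · intro c x _ hx
      rw [star_smul]; exact Submodule.smul_mem _ _ hx

theorem W_mem_polyAlgebra (α : ℝ) (n : ℤ) (φ : C(Circ, ℂ)) : W α n φ ∈ polyAlgebra α :=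
  Submodule.subset_span ⟨(n, φ), rfl⟩

theorem mulOp_mem_closure (α : ℝ) (f : C(Circ, ℂ)) :
    mulOp f ∈ (polyAlgebra α).topologicalClosure := by
  have h1 : f ∈ closure (Submodule.span ℂ (range (fourier (T := 2 * π))) : Set C(Circ, ℂ)) := by
    rw [← Submodule.topologicalClosure_coe, span_fourier_closure_eq_top]
    trivial
  refine map_mem_closure mulOpL.continuous h1 fun g hg => ?_
  refine (Submodule.span_le (p := (Subalgebra.toSubmodule
    (polyAlgebra α).toSubalgebra).comap mulOpL.toLinearMap)).2 ?_ hg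
  rintro _ ⟨n, rfl⟩
  have h := W_mem_polyAlgebra α n 1
  rw [W_one] at h
  exact h

theorem crossedProduct_le (α : ℝ) : crossedProduct α ≤ (polyAlgebra α).topologicalClosure := by
  refine StarSubalgebra.topologicalClosure_minimal (StarAlgebra.adjoin_le ?_)
    (StarSubalgebra.isClosed_topologicalClosure _)
  rintro _ (rfl | ⟨f, rfl⟩)
  · rw [← hatOp_fourier_one, ← W_zero]
    exact StarSubalgebra.le_topologicalClosure _ (W_mem_polyAlgebra α _ _)
  · exact mulOp_mem_closure α f

theorem exists_isCoeff {α : ℝ} (hα : Irrational (α / (2 * π))) {a : B}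
    (ha : a ∈ crossedProduct α) (n : ℤ) : ∃ φ, IsCoeff α n a φ := by
  have h : (polyAlgebra α : Set B) ⊆ coeffDomain α n := by
    refine Submodule.span_le.2 ?_
    rintro _ ⟨⟨m, φ⟩, rfl⟩
    by_cases hm : m = n
    · subst hm; exact ⟨φ, isCoeff_W_self α m φ⟩
    · exact ⟨0, isCoeff_W_of_ne hα hm φ⟩
  exact closure_minimal h (isClosed_coeffDomain hα n) (crossedProduct_le α ha)

/-- A closed subspace invariant under conjugation by `λ₁` contains the Fourier components of its
elements. -/
theorem W_mem_of_isCoeff {α : ℝ} {S : Submodule ℂ B} (hS : IsClosed (S : Set B))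
    (hconj : ∀ a ∈ S, koopman α * (a * star (koopman α)) ∈ S) {a : B} (ha : a ∈ S) {n : ℤ}
    {φ : C(Circ, ℂ)} (hφ : IsCoeff α n a φ) : W α n φ ∈ S := by
  -- The component `W α n φ` is fixed by the twist, so the averages of a = (a - W) + W tend to it,
  -- and each average lies in S.
  have hW : Tendsto (birkhoffAverage ℂ (twist α n) id · (W α n φ)) atTop (𝓝 (W α n φ)) := by
    refine Function.IsFixedPt.tendsto_birkhoffAverage ℂ ?_ id
    rw [Function.IsFixedPt, twist_W, sub_self]
    simp
  have h := hφ.tendsto.add hW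
  simp only [← birkhoffAverage_twist_add, sub_add_cancel, zero_add] at h
  refine hS.mem_of_tendsto h (Eventually.of_forall fun N => ?_)
  have hiter (j : ℕ) : (twist α n)^[j] a ∈ S := by
    induction j with
    | zero => exact ha
    | succ j ih =>
      rw [Function.iterate_succ_apply', twist_apply]
      exact S.smul_mem _ (hconj _ ih)
  exact S.smul_mem _ (S.sum_mem fun j _ => hiter j)

/-- The matrix entry in row j and column k is the coefficient of degree j - k evaluated at kα. -/
theorem IsCoeff.ext {α : ℝ} {a b : B} (h : ∀ n, ∃ φ, IsCoeff α n a φ ∧ IsCoeff α n b φ) :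
    a = b := by
  refine ext_e fun k => eq_of_inner_e fun j => ?_
  obtain ⟨φ, h1, h2⟩ := h (j - k)
  have h3 := h1.inner_eq k
  have h4 := h2.inner_eq k
  rw [add_sub_cancel] at h3 h4
  rw [h3, h4]

/-! ### The group algebra -/

theorem hatOp_mem_groupAlgebra (α : ℝ) (φ : C(Circ, ℂ)) : hatOp α φ ∈ groupAlgebra α :=
  (hat α φ).2

theorem norm_le_norm_hatOp {α : ℝ} (hα : Irrational (α / (2 * π))) (φ : C(Circ, ℂ)) :
    ‖φ‖ ≤ ‖hatOp α φ‖ := by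
  refine norm_le_of_orbit hα fun k => ?_
  have := norm_inner_e_le (W α 0 φ) (k + 0) k
  rwa [inner_W, if_pos rfl, W_zero] at this

/-- The map φ ↦ φ̂ is bounded below, so its range is closed; it contains λ₁. -/
theorem exists_hatOp_eq {α : ℝ} (hα : Irrational (α / (2 * π))) {η : B}
    (hη : η ∈ groupAlgebra α) : ∃ φ, hatOp α φ = η := by
  have hanti : AntilipschitzWith 1 (hatOp α) :=
    AddMonoidHomClass.antilipschitz_of_bound (hatOp α) fun φ => by
      simpa using norm_le_norm_hatOp hα φ
  have huc : UniformContinuous (hatOp α) :=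
    uniformContinuous_of_continuousAt_zero (hatOp α) (continuous_hatOp α).continuousAt
  have hcl : IsClosed ((hatOp α).range : Set B) := hanti.isClosed_range huc
  exact StarAlgebra.elemental.le_of_mem hcl ⟨fourier 1, hatOp_fourier_one α⟩ hη

theorem W_notMem_groupAlgebra {α : ℝ} (hα : Irrational (α / (2 * π))) {n : ℤ} (hn : n ≠ 0)
    {φ : C(Circ, ℂ)} (hφ : φ ≠ 0) : W α n φ ∉ groupAlgebra α := by
  intro h
  obtain ⟨ψ, hψ⟩ := exists_hatOp_eq hα h
  refine hφ (eq_of_orbit hα fun k => ?_)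
  have h1 := inner_W α n n k φ
  rw [← hψ, ← W_zero, inner_W, if_neg hn, if_pos rfl] at h1
  exact h1.symm

/-! ### Ideal functions and set functions -/

theorem notMem_setFunction {α : ℝ} {S : Set B} {n : ℤ} {t : Circ} :
    t ∉ setFunction α S n ↔ ∃ φ, W α n φ ∈ S ∧ φ t ≠ 0 := by
  change ¬ (∀ φ, W α n φ ∈ S → φ t = 0) ↔ _
  push Not
  rfl

theorem isClosed_setFunction (α : ℝ) (S : Set B) (n : ℤ) : IsClosed (setFunction α S n) := by
  have : setFunction α S n = ⋂ φ ∈ {φ | W α n φ ∈ S}, {t | φ t = 0} := by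
    ext t
    simp only [mem_iInter]
    rfl
  rw [this]
  exact isClosed_biInter fun φ _ => isClosed_eq φ.continuous continuous_const

theorem mem_supp_iff {α : ℝ} (hα : Irrational (α / (2 * π))) {S : Submodule ℂ B} {n : ℤ} :
    n ∈ supp α (S : Set B) ↔ ∃ t, t ∉ setFunction α (S : Set B) n := by
  have h0 : (0 : groupAlgebra α) ∈ idealFunction α (S : Set B) n := by
    change mulOp (fourier n) * (0 : B) ∈ S
    rw [mul_zero]
    exact zero_mem S
  have h1 : n ∈ supp α (S : Set B) ↔
      ∃ η : groupAlgebra α, η ∈ idealFunction α (S : Set B) n ∧ η ≠ 0 := by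
    change idealFunction α (S : Set B) n ≠ {0} ↔ _
    rw [Ne, Set.eq_singleton_iff_unique_mem]
    push Not
    exact ⟨fun h => h h0, fun h _ => h⟩
  rw [h1]
  simp only [notMem_setFunction]
  constructor
  · rintro ⟨⟨η, hη⟩, hmem, hne⟩
    obtain ⟨φ, rfl⟩ := exists_hatOp_eq hα hη
    obtain ⟨t, ht⟩ : ∃ t, φ t ≠ 0 := by
      by_contra! h
      have : φ = 0 := ContinuousMap.ext h
      subst this
      exact hne (Subtype.ext (map_zero (hatOp α)))
    exact ⟨t, φ, hmem, ht⟩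
  · rintro ⟨t, φ, hmem, ht⟩
    refine ⟨hat α φ, hmem, fun h => ht ?_⟩
    have h2 : hatOp α φ = hatOp α 0 := (congrArg Subtype.val h).trans (map_zero (hatOp α)).symm
    rw [← W_zero, ← W_zero] at h2
    rw [W_injective hα 0 h2]
    rfl

theorem isNowhereDense_setFunction_iff {α : ℝ} {S : Set B} {n : ℤ} :
    IsNowhereDense (setFunction α S n) ↔
      ∀ V : Set Circ, IsOpen V → V.Nonempty → ∃ t ∈ V, t ∉ setFunction α S n := by
  rw [(isClosed_setFunction α S n).isNowhereDense_iff, interior_eq_empty_iff_dense_compl,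
    dense_iff_inter_open]
  rfl

/-- Stated so that it can be iterated: each use shrinks the open set to avoid one more translated
zero set. -/
theorem exists_add_notMem {α : ℝ} {S : Set B} {n : ℤ} (h : IsNowhereDense (setFunction α S n))
    (s : Circ) {V : Set Circ} (hV : IsOpen V) (hne : V.Nonempty) :
    ∃ V' ⊆ V, IsOpen V' ∧ V'.Nonempty ∧ ∀ t ∈ V', t + s ∉ setFunction α S n := by
  obtain ⟨v, hv⟩ := hne
  obtain ⟨t, ht, ht'⟩ := isNowhereDense_setFunction_iff.1 h ((fun t => t - s) ⁻¹' V)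
    (hV.preimage (continuous_sub_right s)) ⟨v + s, by simpa using hv⟩
  exact ⟨V ∩ (fun t => t + s) ⁻¹' (setFunction α S n)ᶜ, inter_subset_left,
    hV.inter ((isClosed_setFunction α S n).isOpen_compl.preimage (continuous_add_const s)),
    ⟨t - s, ht, by simpa using ht'⟩, fun t ht => ht.2⟩

theorem setFunction_anti {α : ℝ} {S S' : Set B} (h : S ⊆ S') (n : ℤ) :
    setFunction α S' n ⊆ setFunction α S n :=
  fun _ ht φ hφ => ht φ (h hφ)

theorem supp_mono {α : ℝ} (hα : Irrational (α / (2 * π))) {S S' : Submodule ℂ B} (h : S ≤ S') :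
    supp α (S : Set B) ⊆ supp α (S' : Set B) := by
  intro n hn
  obtain ⟨t, ht⟩ := (mem_supp_iff hα).1 hn
  exact (mem_supp_iff hα).2 ⟨t, fun h' => ht (setFunction_anti h n h')⟩

/-- The subspace of operators underlying a `⋆`-subalgebra. -/
abbrev toSubmodule (A : StarSubalgebra ℂ B) : Submodule ℂ B :=
  Subalgebra.toSubmodule A.toSubalgebra

/-- A closed subspace that is stable under multiplication by `A` on both sides. -/
structure IsClosedBimodule (A : StarSubalgebra ℂ B) (S : Submodule ℂ B) : Prop where
  isClosed : IsClosed (S : Set B)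
  mul_left : ∀ a ∈ A, ∀ s ∈ S, a * s ∈ S
  mul_right : ∀ a ∈ A, ∀ s ∈ S, s * a ∈ S

theorem isClosedBimodule_of_le {A A' : StarSubalgebra ℂ B} (hA' : IsClosed (A' : Set B))
    (h : A ≤ A') : IsClosedBimodule A (toSubmodule A') :=
  ⟨hA', fun _ ha _ hs => A'.mul_mem (h ha) hs, fun _ ha _ hs => A'.mul_mem hs (h ha)⟩

theorem koopman_mem {α : ℝ} {A : StarSubalgebra ℂ B} (hA : IsIntermediate α A) : koopman α ∈ A :=
  hA.groupAlgebra_le (StarAlgebra.elemental.self_mem ℂ (koopman α))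

theorem IsClosedBimodule.exists_W_mem {α : ℝ} (hα : Irrational (α / (2 * π)))
    {A : StarSubalgebra ℂ B} (hA : IsIntermediate α A) {S : Submodule ℂ B}
    (hS : IsClosedBimodule A S) {a : B} (ha : a ∈ S) (hac : a ∈ crossedProduct α) (n : ℤ) :
    ∃ φ, IsCoeff α n a φ ∧ W α n φ ∈ S := by
  obtain ⟨φ, hφ⟩ := exists_isCoeff hα hac n
  exact ⟨φ, hφ, W_mem_of_isCoeff hS.isClosed (fun b hb => hS.mul_left _ (koopman_mem hA) _
    (hS.mul_right _ (star_mem (koopman_mem hA)) _ hb)) ha hφ⟩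

/-- The product of the two witnesses has weight (φ ∘ τᵐ)ψ, whose value at t is a product of nonzero
numbers. -/
theorem notMem_setFunction_left {α : ℝ} {A : StarSubalgebra ℂ B} {S : Submodule ℂ B}
    (hS : IsClosedBimodule A S) {n m : ℤ} {t : Circ}
    (hn : t + m • (α : Circ) ∉ setFunction α (A : Set B) n)
    (hm : t ∉ setFunction α (S : Set B) m) : t ∉ setFunction α (S : Set B) (n + m) := by
  obtain ⟨φ, hφ, hφt⟩ := notMem_setFunction.1 hn
  obtain ⟨ψ, hψ, hψt⟩ := notMem_setFunction.1 hm
  refine notMem_setFunction.2 ⟨shift α m φ * ψ, ?_, mul_ne_zero hφt hψt⟩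
  rw [← W_mul_W]
  exact hS.mul_left _ hφ _ hψ

theorem notMem_setFunction_right {α : ℝ} {A : StarSubalgebra ℂ B} {S : Submodule ℂ B}
    (hS : IsClosedBimodule A S) {n m : ℤ} {t : Circ}
    (hn : t + m • (α : Circ) ∉ setFunction α (S : Set B) n)
    (hm : t ∉ setFunction α (A : Set B) m) : t ∉ setFunction α (S : Set B) (n + m) := by
  obtain ⟨φ, hφ, hφt⟩ := notMem_setFunction.1 hn
  obtain ⟨ψ, hψ, hψt⟩ := notMem_setFunction.1 hm
  refine notMem_setFunction.2 ⟨shift α m φ * ψ, ?_, mul_ne_zero hφt hψt⟩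
  rw [← W_mul_W]
  exact hS.mul_right _ hψ _ hφ

theorem notMem_setFunction_neg {α : ℝ} {A : StarSubalgebra ℂ B} {n : ℤ} {t : Circ}
    (hn : t ∉ setFunction α (A : Set B) n) :
    t + n • (α : Circ) ∉ setFunction α (A : Set B) (-n) := by
  obtain ⟨φ, hφ, hφt⟩ := notMem_setFunction.1 hn
  refine notMem_setFunction.2 ⟨shift α (-n) (star φ), ?_, ?_⟩
  · rw [← star_W]
    exact A.star_mem' hφ
  · simpa [shift_apply] using hφt

theorem notMem_setFunction_zero (α : ℝ) (A : StarSubalgebra ℂ B) (t : Circ) :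
    t ∉ setFunction α (A : Set B) 0 := by
  refine notMem_setFunction.2 ⟨1, ?_, one_ne_zero⟩
  rw [W_zero, map_one]
  exact A.one_mem

/-- If all components outside degree 0 vanished, each element would equal its degree 0 component,
which is some φ̂. -/
theorem exists_ne_zero_mem_supp {α : ℝ} (hα : Irrational (α / (2 * π))) {A : StarSubalgebra ℂ B}
    (hA : IsIntermediate α A) (hne : A ≠ groupAlgebra α) :
    ∃ n ∈ supp α (A : Set B), n ≠ 0 := by
  by_contra! h
  refine hne (le_antisymm (fun a ha => ?_) hA.groupAlgebra_le)
  have hex := (isClosedBimodule_of_le hA.isClosed le_rfl).exists_W_mem hα hA ha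
    (hA.le_crossedProduct ha)
  obtain ⟨φ, hφ, -⟩ := hex 0
  have : a = W α 0 φ := by
    refine IsCoeff.ext (α := α) fun n => ?_
    by_cases hn : n = 0
    · subst hn
      exact ⟨φ, hφ, isCoeff_W_self α 0 φ⟩
    · obtain ⟨ψ, hψ, hψA⟩ := hex n
      have hψ0 : ψ = 0 := by
        ext t
        by_contra ht
        exact hn (h n ((mem_supp_iff (S := toSubmodule A) hα).2
          ⟨t, notMem_setFunction.2 ⟨ψ, hψA, ht⟩⟩))
      exact ⟨0, hψ0 ▸ hψ, isCoeff_W_of_ne hα (Ne.symm hn) φ⟩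
  rw [this, W_zero]
  exact hatOp_mem_groupAlgebra α φ

theorem ne_groupAlgebra_of_mem_supp {α : ℝ} (hα : Irrational (α / (2 * π)))
    {A : StarSubalgebra ℂ B} {n : ℤ} (hn : n ≠ 0) (hmem : n ∈ supp α (A : Set B)) :
    A ≠ groupAlgebra α := by
  rintro rfl
  obtain ⟨t, ht⟩ := (mem_supp_iff (S := toSubmodule (groupAlgebra α)) hα).1 hmem
  obtain ⟨φ, hφ, hφt⟩ := notMem_setFunction.1 ht
  refine W_notMem_groupAlgebra hα hn (φ := φ) ?_ hφ
  rintro rfl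
  exact hφt rfl

/-! ### Residual algebras -/

/-- The support of a residual algebra as a subgroup of `ℤ`. -/
theorem IsResidual.exists_addSubgroup {α : ℝ} (hα : Irrational (α / (2 * π)))
    {A : StarSubalgebra ℂ B} (hA : IsResidual α A) :
    ∃ G : AddSubgroup ℤ, (G : Set ℤ) = supp α (A : Set B) := by
  have hmem {n : ℤ} := mem_supp_iff (S := toSubmodule A) hα (n := n)
  refine ⟨{ carrier := supp α (A : Set B), add_mem' := ?_, zero_mem' := ?_, neg_mem' := ?_ }, rfl⟩
  · intro n m hn hm
    -- Nowhere density provides a point off the zero set of degree m whose translate by mα is off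
    -- that of degree n.
    obtain ⟨V, hVm, -, ⟨v, hv⟩, hV⟩ := exists_add_notMem (hA.isNowhereDense n hn) (m • (α : Circ))
      (isClosed_setFunction α (A : Set B) m).isOpen_compl (hmem.1 hm)
    exact hmem.2 ⟨v, notMem_setFunction_left
      (isClosedBimodule_of_le hA.isIntermediate.isClosed le_rfl) (hV v hv) (hVm hv)⟩
  · exact hmem.2 ⟨0, notMem_setFunction_zero α A 0⟩
  · intro n hn
    obtain ⟨t, ht⟩ := hmem.1 hn
    exact hmem.2 ⟨_, notMem_setFunction_neg ht⟩

theorem IsResidual.mul_mem_supp {α : ℝ} (hα : Irrational (α / (2 * π)))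
    {A : StarSubalgebra ℂ B} (hA : IsResidual α A) (j : ℤ) {m : ℤ}
    (hm : m ∈ supp α (A : Set B)) : j * m ∈ supp α (A : Set B) := by
  obtain ⟨G, hG⟩ := hA.exists_addSubgroup hα
  rw [← hG] at hm ⊢
  simpa using G.zsmul_mem hm j

/-- Conjugating by elements of a residual algebra spreads a nonzero coefficient over a dense
set. -/
theorem IsResidual.isNowhereDense_of_bimodule {α : ℝ} (hα : Irrational (α / (2 * π)))
    {A : StarSubalgebra ℂ B} (hA : IsResidual α A) {S : Submodule ℂ B}
    (hS : IsClosedBimodule A S) {n : ℤ} (hn : n ∈ supp α (S : Set B)) :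
    IsNowhereDense (setFunction α (S : Set B) n) := by
  refine isNowhereDense_setFunction_iff.2 fun V hV hne => ?_
  obtain ⟨m, hm, hm0⟩ := exists_ne_zero_mem_supp hα hA.isIntermediate hA.ne_groupAlgebra
  obtain ⟨t₀, ht₀⟩ := hne
  obtain ⟨j, hj⟩ := exists_zsmul_mem hα hm0 (isClosed_setFunction α (S : Set B) n).isOpen_compl
    ((mem_supp_iff hα).1 hn) t₀
  have hp := hA.isNowhereDense _ (hA.mul_mem_supp hα j hm)
  have hq := hA.isNowhereDense _ (hA.mul_mem_supp hα (-j) hm)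
  set p := j * m with hp_def
  have hV₁ : IsOpen (V ∩ (fun t => t + p • (α : Circ)) ⁻¹' (setFunction α (S : Set B) n)ᶜ) :=
    hV.inter ((isClosed_setFunction α _ n).isOpen_compl.preimage (continuous_add_const _))
  obtain ⟨V₂, hV₂, ho₂, hne₂, h₂⟩ := exists_add_notMem hp 0 hV₁ ⟨t₀, ht₀, hj⟩
  -- The left factor of degree -p acts after a product of degree n + p, so its weight is read at t +
  -- (n + p)α.
  obtain ⟨V₃, hV₃, -, ⟨t, ht⟩, h₃⟩ := exists_add_notMem hq ((n + p) • (α : Circ)) ho₂ hne₂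
  refine ⟨t, (hV₂ (hV₃ ht)).1, ?_⟩
  have e1 : t ∉ setFunction α (A : Set B) p := by simpa using h₂ t (hV₃ ht)
  have e2 := notMem_setFunction_right hS (hV₂ (hV₃ ht)).2 e1
  have e3 := notMem_setFunction_left hS (h₃ t ht) e2
  rwa [neg_mul, ← hp_def, add_comm n p, neg_add_cancel_left] at e3

theorem IsResidual.mono {α : ℝ} (hα : Irrational (α / (2 * π))) {A A' : StarSubalgebra ℂ B}
    (hA : IsResidual α A) (hA' : IsIntermediate α A') (h : A ≤ A') : IsResidual α A' := by
  refine ⟨hA', ?_, fun n hn =>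
    hA.isNowhereDense_of_bimodule hα (isClosedBimodule_of_le hA'.isClosed h) hn⟩
  obtain ⟨m, hm, hm0⟩ := exists_ne_zero_mem_supp hα hA.isIntermediate hA.ne_groupAlgebra
  exact ne_groupAlgebra_of_mem_supp hα hm0
    (supp_mono hα (S := toSubmodule A) (S' := toSubmodule A') h hm)

/-- In each degree the weights form an ideal of C(S¹), so the product of a weight from each algebra
belongs to both. -/
theorem notMem_setFunction_inf {α : ℝ} {A₁ A₂ : StarSubalgebra ℂ B} (h₁ : IsIntermediate α A₁)
    (h₂ : IsIntermediate α A₂) {n : ℤ} {t : Circ} (ht₁ : t ∉ setFunction α (A₁ : Set B) n)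
    (ht₂ : t ∉ setFunction α (A₂ : Set B) n) :
    t ∉ setFunction α ((A₁ ⊓ A₂ : StarSubalgebra ℂ B) : Set B) n := by
  obtain ⟨φ, hφ, hφt⟩ := notMem_setFunction.1 ht₁
  obtain ⟨ψ, hψ, hψt⟩ := notMem_setFunction.1 ht₂
  have key (f g : C(Circ, ℂ)) : W α n (f * g) = W α n f * hatOp α g := by
    rw [W_apply, W_apply, map_mul, mul_assoc]
  refine notMem_setFunction.2 ⟨φ * ψ, ⟨?_, ?_⟩, mul_ne_zero hφt hψt⟩
  · rw [key]
    exact A₁.mul_mem hφ (h₁.groupAlgebra_le (hatOp_mem_groupAlgebra α ψ))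
  · rw [mul_comm φ ψ, key]
    exact A₂.mul_mem hψ (h₂.groupAlgebra_le (hatOp_mem_groupAlgebra α φ))

theorem IsIntermediate.inf {α : ℝ} {A₁ A₂ : StarSubalgebra ℂ B} (h₁ : IsIntermediate α A₁)
    (h₂ : IsIntermediate α A₂) : IsIntermediate α (A₁ ⊓ A₂) where
  isClosed := by
    rw [StarSubalgebra.coe_inf]
    exact h₁.isClosed.inter h₂.isClosed
  groupAlgebra_le := le_inf h₁.groupAlgebra_le h₂.groupAlgebra_le
  le_crossedProduct := inf_le_left.trans h₁.le_crossedProduct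

theorem IsResidual.inf {α : ℝ} (hα : Irrational (α / (2 * π))) {A₁ A₂ : StarSubalgebra ℂ B}
    (h₁ : IsResidual α A₁) (h₂ : IsResidual α A₂) : IsResidual α (A₁ ⊓ A₂) := by
  have key {n : ℤ} (hn₁ : n ∈ supp α (A₁ : Set B)) (hn₂ : n ∈ supp α (A₂ : Set B)) :
      IsNowhereDense (setFunction α ((A₁ ⊓ A₂ : StarSubalgebra ℂ B) : Set B) n) := by
    refine isNowhereDense_setFunction_iff.2 fun V hV hne => ?_
    obtain ⟨V₁, hV₁, ho₁, hne₁, hv₁⟩ := exists_add_notMem (h₁.isNowhereDense n hn₁) 0 hV hne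
    obtain ⟨V₂, hV₂, -, ⟨t, ht⟩, hv₂⟩ := exists_add_notMem (h₂.isNowhereDense n hn₂) 0 ho₁ hne₁
    exact ⟨t, hV₁ (hV₂ ht), notMem_setFunction_inf h₁.isIntermediate h₂.isIntermediate
      (by simpa using hv₁ t (hV₂ ht)) (by simpa using hv₂ t ht)⟩
  refine ⟨h₁.isIntermediate.inf h₂.isIntermediate, ?_, fun n hn => key
    (supp_mono hα (S := toSubmodule (A₁ ⊓ A₂)) (S' := toSubmodule A₁) (fun _ hx => hx.1) hn)
    (supp_mono hα (S := toSubmodule (A₁ ⊓ A₂)) (S' := toSubmodule A₂) (fun _ hx => hx.2) hn)⟩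
  obtain ⟨m₁, hm₁, hm₁0⟩ := exists_ne_zero_mem_supp hα h₁.isIntermediate h₁.ne_groupAlgebra
  obtain ⟨m₂, hm₂, hm₂0⟩ := exists_ne_zero_mem_supp hα h₂.isIntermediate h₂.ne_groupAlgebra
  -- Both supports are subgroups, so m₁m₂ is a common nonzero element.
  have hnd := key (mul_comm m₁ m₂ ▸ h₁.mul_mem_supp hα m₂ hm₁) (h₂.mul_mem_supp hα m₁ hm₂)
  obtain ⟨t, -, ht⟩ := isNowhereDense_setFunction_iff.1 hnd univ isOpen_univ univ_nonempty
  exact ne_groupAlgebra_of_mem_supp hα (mul_ne_zero hm₁0 hm₂0)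
    ((mem_supp_iff (S := toSubmodule (A₁ ⊓ A₂)) hα).2 ⟨t, ht⟩)

theorem isResidual_sInf {α : ℝ} (hα : Irrational (α / (2 * π))) {F : Set (StarSubalgebra ℂ B)}
    (hF : F.Finite) : F.Nonempty → (∀ A ∈ F, IsResidual α A) → IsResidual α (sInf F) := by
  induction F, hF using Set.Finite.induction_on with
  | empty => exact fun h => absurd h not_nonempty_empty
  | @insert A F _ _ ih =>
    intro _ h
    rcases F.eq_empty_or_nonempty with rfl | hne
    · rw [insert_empty_eq, sInf_singleton]
      exact h A (mem_insert _ _)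
    · rw [sInf_insert]
      exact (h A (mem_insert _ _)).inf hα (ih hne fun A' hA' => h A' (mem_insert_of_mem _ hA'))

/-! ### Ideals -/

/-- A two-sided ideal of `A` as a subspace of operators. -/
def idealSubmodule {A : StarSubalgebra ℂ B} (J : TwoSidedIdeal A) : Submodule ℂ B where
  carrier := idealCarrier J
  add_mem' := by
    rintro _ _ ⟨a, ha, rfl⟩ ⟨b, hb, rfl⟩
    exact ⟨a + b, J.add_mem ha hb, rfl⟩
  zero_mem' := ⟨0, J.zero_mem, rfl⟩
  smul_mem' := by
    rintro c _ ⟨a, ha, rfl⟩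
    refine ⟨c • a, ?_, rfl⟩
    rw [← one_mul a, ← smul_mul_assoc]
    exact J.mul_mem_left _ _ ha

theorem isClosedBimodule_idealSubmodule {A : StarSubalgebra ℂ B} (hA : IsClosed (A : Set B))
    {J : TwoSidedIdeal A} (hJ : IsClosed (J : Set A)) :
    IsClosedBimodule A (idealSubmodule J) where
  isClosed := hA.isClosedEmbedding_subtypeVal.isClosedMap _ hJ
  mul_left := by
    rintro a ha _ ⟨b, hb, rfl⟩
    exact ⟨⟨a, ha⟩ * b, J.mul_mem_left _ _ hb, rfl⟩
  mul_right := by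
    rintro a ha _ ⟨b, hb, rfl⟩
    exact ⟨b * ⟨a, ha⟩, J.mul_mem_right _ _ hb, rfl⟩

theorem idealSubmodule_le {A : StarSubalgebra ℂ B} (J : TwoSidedIdeal A) :
    idealSubmodule J ≤ toSubmodule A := by
  rintro _ ⟨a, -, rfl⟩
  exact a.2

theorem exists_mem_supp_of_ne_zero {α : ℝ} (hα : Irrational (α / (2 * π)))
    {A : StarSubalgebra ℂ B} (hA : IsIntermediate α A) {S : Submodule ℂ B}
    (hS : IsClosedBimodule A S) (hle : S ≤ toSubmodule A) (hne : S ≠ ⊥) :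
    ∃ n, n ∈ supp α (S : Set B) := by
  by_contra! h
  refine hne (Submodule.eq_bot_iff _ |>.2 fun a ha => ?_)
  refine IsCoeff.ext (α := α) fun n => ?_
  obtain ⟨φ, hφ, hφS⟩ := hS.exists_W_mem hα hA ha (hA.le_crossedProduct (hle ha)) n
  have : φ = 0 := by
    ext t
    by_contra ht
    exact h n ((mem_supp_iff hα).2 ⟨t, notMem_setFunction.2 ⟨φ, hφS, ht⟩⟩)
  exact ⟨0, this ▸ hφ, isCoeff_zero α n⟩

/-- Multiplying e^{inx} φ̂ in S by its adjoint, which lies in A, gives weight |φ|² in degree 0. -/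
theorem zero_mem_supp_of_mem_supp {α : ℝ} (hα : Irrational (α / (2 * π)))
    {A : StarSubalgebra ℂ B} {S : Submodule ℂ B} (hS : IsClosedBimodule A S)
    (hle : S ≤ toSubmodule A) {n : ℤ} (hn : n ∈ supp α (S : Set B)) :
    0 ∈ supp α (S : Set B) := by
  obtain ⟨t, ht⟩ := (mem_supp_iff hα).1 hn
  have h1 : t ∉ setFunction α (A : Set B) n := fun h => ht (setFunction_anti hle n h)
  have h2 := notMem_setFunction_left hS (notMem_setFunction_neg h1) ht
  rw [neg_add_cancel] at h2
  exact (mem_supp_iff hα).2 ⟨t, h2⟩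

/-- Weights of A in degree k are nonzero somewhere on the open set where S does not vanish in degree
0; multiply there. -/
theorem IsResidual.supp_eq {α : ℝ} (hα : Irrational (α / (2 * π)))
    {A : StarSubalgebra ℂ B} (hA : IsResidual α A) {S : Submodule ℂ B}
    (hS : IsClosedBimodule A S) (hle : S ≤ toSubmodule A) (h0 : 0 ∈ supp α (S : Set B)) :
    supp α (S : Set B) = supp α (A : Set B) := by
  refine Subset.antisymm (supp_mono hα hle) fun k hk => ?_
  obtain ⟨t, ht, ht'⟩ := isNowhereDense_setFunction_iff.1 (hA.isNowhereDense k hk) _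
    (isClosed_setFunction α (S : Set B) 0).isOpen_compl ((mem_supp_iff hα).1 h0)
  have := notMem_setFunction_left hS (n := k) (m := 0) (t := t) (by simpa using ht') ht
  rw [add_zero] at this
  exact (mem_supp_iff hα).2 ⟨t, this⟩

theorem IsResidual.setFunction_subset_omegaSet {α : ℝ} (hα : Irrational (α / (2 * π)))
    {A : StarSubalgebra ℂ B} (hA : IsResidual α A) {S : Submodule ℂ B}
    (hS : IsClosedBimodule A S) (h0 : 0 ∈ supp α (S : Set B)) {k : ℤ}
    (hk : k ∈ supp α (A : Set B)) : setFunction α (S : Set B) k ⊆ omegaSet α A := by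
  intro t ht
  by_contra hΩ
  have hΩ' {m n : ℤ} (hm : m ∈ supp α (A : Set B)) (hn : n ∈ supp α (A : Set B)) :
      t + m • (α : Circ) ∉ setFunction α (A : Set B) n := by
    intro h
    refine hΩ ?_
    simp only [omegaSet, mem_iUnion]
    exact ⟨m, hm, n, hn, _, h, add_sub_cancel_right _ _⟩
  obtain ⟨G, hG⟩ := hA.exists_addSubgroup hα
  obtain ⟨m, hm, hm0⟩ := exists_ne_zero_mem_supp hα hA.isIntermediate hA.ne_groupAlgebra
  -- Choose p = jm with S nonvanishing in degree 0 at t + pα. Factors of degrees k - p, 0, p then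
  -- give degree k at t; that t lies outside Ω makes both outer factors available.
  obtain ⟨j, hj⟩ := exists_zsmul_mem hα hm0 (isClosed_setFunction α (S : Set B) 0).isOpen_compl
    ((mem_supp_iff hα).1 h0) t
  have hp := hA.mul_mem_supp hα j hm
  set p := j * m
  have hkp : k - p ∈ supp α (A : Set B) := by
    rw [← hG] at hk hp ⊢
    exact G.sub_mem hk hp
  have h0A : (0 : ℤ) ∈ supp α (A : Set B) := by
    rw [← hG]
    exact G.zero_mem
  have e1 : t ∉ setFunction α (A : Set B) p := by simpa using hΩ' h0A hp
  have e2 := notMem_setFunction_left hS (n := k - p) (m := 0) (t := t + p • (α : Circ))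
    (by simpa using hΩ' hp hkp) hj
  have e3 := notMem_setFunction_right hS e2 e1
  rw [add_zero, sub_add_cancel] at e3
  exact e3 ht

/-! ### The center -/

/-- The operators fixed by conjugation with λ₁ form a closed invariant subspace, so it contains the
component of degree n; but conjugation multiplies that component by e^{inα} ≠ 1. -/
theorem isCoeff_zero_of_commute {α : ℝ} (hα : Irrational (α / (2 * π))) {a : B}
    (ha : a ∈ crossedProduct α) (hcomm : koopman α * a = a * koopman α) {n : ℤ} (hn : n ≠ 0) :
    IsCoeff α n a 0 := by
  have hu := (Unitary.mem_iff.1 (koopman_mem_unitary α)).2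
  have htw (b : B) : twist α 0 b = koopman α * (b * star (koopman α)) := by
    rw [twist_apply, neg_zero]
    simp
  have hker {b : B} : b ∈ LinearMap.ker (twist α 0 - LinearMap.id) ↔
      koopman α * (b * star (koopman α)) = b := by
    rw [LinearMap.mem_ker, LinearMap.sub_apply, LinearMap.id_apply, sub_eq_zero, htw]
  obtain ⟨φ, hφ⟩ := exists_isCoeff hα ha n
  have hcl : IsClosed (LinearMap.ker (twist α 0 - LinearMap.id) : Set B) :=
    isClosed_eq ((lipschitzWith_twist α 0).continuous.sub continuous_id) continuous_const
  have hW := W_mem_of_isCoeff hcl (a := a) (fun b hb => (hker.1 hb).symm ▸ hb)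
    (hker.2 (by rw [← mul_assoc, hcomm, mul_assoc, hu, mul_one])) hφ
  rw [LinearMap.mem_ker, LinearMap.sub_apply, LinearMap.id_apply, twist_W, sub_zero] at hW
  have hW1 : ((fourier n : C(Circ, ℂ)) (α : Circ) - 1) • W α n φ = 0 := by
    rw [sub_smul, one_smul, hW]
  have hW0 := (smul_eq_zero.1 hW1).resolve_left
    (sub_ne_zero.2 (fourier_alpha_ne_one hα hn))
  have : φ = 0 := W_injective hα n (hW0.trans (map_zero _).symm)
  exact this ▸ hφ

theorem center_eq_bot {α : ℝ} (hα : Irrational (α / (2 * π))) {A : StarSubalgebra ℂ B}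
    (hA : IsIntermediate α A) {n : ℤ} (hn : n ≠ 0)
    (hnd : IsNowhereDense (setFunction α (A : Set B) n)) : Subalgebra.center ℂ A = ⊥ := by
  refine eq_bot_iff.2 fun x hx => ?_
  have hcomm (b : B) (hb : b ∈ A) : b * x = x * b :=
    congrArg Subtype.val (Subalgebra.mem_center_iff.1 hx ⟨b, hb⟩)
  have hxc := hA.le_crossedProduct x.2
  obtain ⟨φ, hφ⟩ := exists_isCoeff hα hxc 0
  have hx0 : (x : B) = W α 0 φ := by
    refine IsCoeff.ext (α := α) fun m => ?_
    by_cases hm : m = 0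
    · subst hm
      exact ⟨φ, hφ, isCoeff_W_self α 0 φ⟩
    · exact ⟨0, isCoeff_zero_of_commute hα hxc (hcomm _ (koopman_mem hA)) hm,
        isCoeff_W_of_ne hα (Ne.symm hm) φ⟩
  -- Commuting with e^{inx} ψ̂ gives ψφ = (φ ∘ τⁿ)ψ; cancel ψ where it is nonzero. Such points, over
  -- all admissible ψ, are dense.
  have hinv : shift α n φ = φ := by
    refine ContinuousMap.coe_injective ?_
    have hd : Dense (setFunction α (A : Set B) n)ᶜ := by
      rwa [(isClosed_setFunction α _ n).isNowhereDense_iff,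
        interior_eq_empty_iff_dense_compl] at hnd
    refine Continuous.ext_on hd (shift α n φ).continuous φ.continuous fun t ht => ?_
    obtain ⟨ψ, hψ, hψt⟩ := notMem_setFunction.1 ht
    have h := hcomm _ hψ
    rw [hx0, W_mul_W, W_mul_W, zero_add, add_zero] at h
    have h1 := DFunLike.congr_fun (W_injective hα n h) t
    simp only [ContinuousMap.mul_apply, shift_apply, zero_smul, add_zero] at h1
    rw [mul_comm] at h1
    exact (mul_right_cancel₀ hψt h1).symm
  have horbit (j : ℤ) : φ (j • n • (α : Circ)) = φ 0 := by
    have hstep (t : Circ) : φ (t + n • (α : Circ)) = φ t := DFunLike.congr_fun hinv t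
    have hper : Function.Periodic φ (n • (α : Circ)) := hstep
    exact hper.zsmul_eq j
  have hconst : φ = algebraMap ℂ C(Circ, ℂ) (φ 0) := by
    refine ContinuousMap.coe_injective ?_
    exact (denseRange_zsmul hα hn).equalizer φ.continuous (map_continuous _)
      (funext fun j => horbit j)
  refine Algebra.mem_bot.2 ⟨φ 0, Subtype.ext ?_⟩
  rw [hx0, W_zero, hconst, AlgHomClass.commutes]
  simp

end RotationAlgebra

end

open RotationAlgebra in
theorem theorem1p5 (α : ℝ) (hα : Irrational (α / (2 * Real.pi))) :
    -- an intermediate algebra containing a residual one is residual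
    (∀ A A' : StarSubalgebra ℂ RotationAlgebra.B,
      RotationAlgebra.IsResidual α A → RotationAlgebra.IsIntermediate α A' → A ≤ A' →
        RotationAlgebra.IsResidual α A') ∧
    -- intersections of two, and of finitely many, residual algebras are residual
    (∀ A₁ A₂ : StarSubalgebra ℂ RotationAlgebra.B,
      RotationAlgebra.IsResidual α A₁ → RotationAlgebra.IsResidual α A₂ →
        RotationAlgebra.IsResidual α (A₁ ⊓ A₂)) ∧
    (∀ F : Set (StarSubalgebra ℂ RotationAlgebra.B), F.Finite → F.Nonempty →
      (∀ A ∈ F, RotationAlgebra.IsResidual α A) → RotationAlgebra.IsResidual α (sInf F)) ∧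
    -- the support is a subgroup
    (∀ A : StarSubalgebra ℂ RotationAlgebra.B, RotationAlgebra.IsResidual α A →
      ∃ G : AddSubgroup ℤ, (G : Set ℤ) = RotationAlgebra.supp α (A : Set RotationAlgebra.B)) ∧
    -- nonzero closed two-sided ideals
    (∀ A : StarSubalgebra ℂ RotationAlgebra.B, RotationAlgebra.IsResidual α A →
      ∀ J : TwoSidedIdeal A, IsClosed (J : Set A) → J ≠ ⊥ →
        RotationAlgebra.supp α (RotationAlgebra.idealCarrier J)
          = RotationAlgebra.supp α (A : Set RotationAlgebra.B) ∧
        (∀ k ∈ RotationAlgebra.supp α (A : Set RotationAlgebra.B),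
          RotationAlgebra.setFunction α (RotationAlgebra.idealCarrier J) k
            ⊆ RotationAlgebra.omegaSet α A) ∧
        RotationAlgebra.IsResidualIdeal α J) ∧
    -- residual algebras have trivial center
    (∀ A : StarSubalgebra ℂ RotationAlgebra.B, RotationAlgebra.IsResidual α A →
      Subalgebra.center ℂ A = ⊥) ∧
    -- one nowhere dense value away from 0 already suffices
    (∀ A : StarSubalgebra ℂ RotationAlgebra.B, RotationAlgebra.IsIntermediate α A →
      (∃ n : ℤ, n ≠ 0 ∧
        IsNowhereDense (RotationAlgebra.setFunction α (A : Set RotationAlgebra.B) n)) →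
      Subalgebra.center ℂ A = ⊥) := by
  refine ⟨fun A A' hA hA' h => hA.mono hα hA' h, fun A₁ A₂ h₁ h₂ => h₁.inf hα h₂,
    fun F hF hne h => isResidual_sInf hα hF hne h, fun A hA => hA.exists_addSubgroup hα,
    fun A hA J hJ hJne => ?_, fun A hA => ?_, fun A hA ⟨n, hn, hnd⟩ => center_eq_bot hα hA hn hnd⟩
  · have hS := isClosedBimodule_idealSubmodule hA.isIntermediate.isClosed hJ
    have hle := idealSubmodule_le J
    have hne : idealSubmodule J ≠ ⊥ := by
      refine fun h => hJne (le_bot_iff.1 fun a ha => ?_)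
      have : (a : B) ∈ idealSubmodule J := ⟨a, ha, rfl⟩
      rw [h, Submodule.mem_bot] at this
      exact (TwoSidedIdeal.mem_bot _).2 (Subtype.ext this)
    obtain ⟨n, hn⟩ := exists_mem_supp_of_ne_zero hα hA.isIntermediate hS hle hne
    have h0 := zero_mem_supp_of_mem_supp hα hS hle hn
    exact ⟨hA.supp_eq hα hS hle h0, fun k hk => hA.setFunction_subset_omegaSet hα hS h0 hk,
      hJ, hJne, fun k hk => hA.isNowhereDense_of_bimodule hα hS hk⟩
  · obtain ⟨m, hm, hm0⟩ := exists_ne_zero_mem_supp hα hA.isIntermediate hA.ne_groupAlgebra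
    exact center_eq_bot hα hA.isIntermediate hm0 (hA.isNowhereDense m hm)
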